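/- **Setting.** Let $G=(V,E)$ be a finite, connected, simple graph with at least one edge, embedded in the plane, and let $(\theta_e)_{e\in E}$ be real numbers. Let $d_1,\dots,d_n$ be the oriented edges of $G$ having the outer face on their left, listed so that each $d_i$ is followed by $d_{i+1}$ along the boundary of the outer face (indices modulo $n$). Write $c_i$ for the corner of the outer face at the origin $x_i$ of $d_i$, lying immediately counterclockwise of $d_i$, and let $(\theta^\partial_i)_{1\le i\le n}$ be real numbers. (For a regular isoradial embedding of $G$ one takes for $\theta_e$ and $\theta^\partial_i$ the rhombus half-angles; the statement holds for arbitrary real values.) **Oriented spanning trees.** For a finite directed multigraph $\vec H$ with a vertex $\mathbf r$, an $\mathbf r$-rooted oriented spanning tree ($^{\mathbf r}$OST) is a set of oriented edges that contains no cycle (orientations being forgotten; loops and pairs of parallel edges are cycles) and in which each vertex other than $\mathbf r$ has an outgoing edge. For weights $\tau$ put $Z^{\mathbf r}_{\mathrm{OST}}(\vec H,\tau)=\sum_{T}\prod_{\mathsf e\in T}\tau_{\mathsf e}$, the sum being over all $^{\mathbf r}$OSTs. For an undirected multigraph, each edge is replaced by two opposite oriented edges of the same weight. **The directed graph $\vec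 G$ and the weights $\rho$.** For each oriented edge $d$ of $G$, with underlying edge $e$, take a black vertex $b_d$ on the left and a white vertex $w_d$ on the right of $d$, both near the half of $e$ at the origin of $d$. Write $\bar d$ for the reversal of $d$, and $\sigma d$ for the next oriented edge after $d$ counterclockwise around its origin. There are oriented edges $(w_d,b_d)$ of weight $\rho=i\cos\theta_e$ (crossing a half of the primal edge $e$) and $(w_{\bar d},b_d)$ of weight $\rho=\sin\theta_e$ (crossing a half of the dual edge $e^*$). If the corner between $d$ and $\sigma d$ is not in the outer face, $b_d$ and $w_{\sigma d}$ are merged into a single vertex. Finally a root $\mathbf r$ is added and, for every outer corner $c_i$, two oriented edges: $(b_{d_i},w_{\sigma d_i})$ of weight $1$ and $(b_{d_i},\mathbf r)$ of weight $e^{-i\theta_i^\partial}-1$. **The extended double graph $G^{\mathrm D}$ and the weights $\rho^*$.** The extended dual of $G$ has as vertices the inner faces of $G$ and $n$ vertices $u_1,\dots,u_n$ into which the dual vertex of the outer face is split. The edge dual to $e$ joins the dual vertices on the two sides of $e$, the outer side of $d_i$ giving $u_i$; moreover, for every $i$, a boundary edge joins $u_{i-1}$ and $u_i$. Its dual graph,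 the extended graph, is $G$ with, for every outer corner $c_i$, an additional edge from $x_i$ to a vertex $\mathbf r$, dual to $u_{i-1}u_i$. The graph $G^{\mathrm D}$ is the superposition of the two with a white vertex at each crossing of an edge and its dual, from which the half-edges at $\mathbf r$ are removed. Its edges are half-edges, with weights: $\rho^*=\sin\theta_e$ on halves of $e\in E$; $\rho^*=i\cos\theta_e$ on halves of the dual edge $e^*$ of $e\in E$; $\rho^*=1$ on halves of $u_{i-1}u_i$; $\rho^*=e^{-i\theta^\partial_i}-1$ on the half at $x_i$ of the edge $x_i\mathbf r$. **Local constraints.** A set $S$ of edges of $G^{\mathrm D}$ satisfies: 1. if, at the white vertex of every $e\in E$ and for each of the two oriented edges $d$ with underlying edge $e$, $S$ contains exactly one of the half of $e$ at the origin of $d$ and the half of $e^*$ at the dual vertex on the right of $d$ (that is, $S$ is in one of four configurations at this white vertex: both primal halves, both dual halves, or, for one of the two $d$, the primal half at the origin of $d$ and the dual half on the left of $d$); 2. if, for every $i$, at the white vertex of $u_{i-1}u_i$, $S$ contains the half-edge at $u_{i-1}$ and exactly one of the half-edges at $x_i$ and at $u_i$. **Proposition.** For every $\mathbf s\in\{u_1,\dots,u_n\}$,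 let $Z^{\mathbf s}_{\mathrm{OST},(1,2)}(G^{\mathrm D},\rho^*)$ be the sum of $\prod_{\mathsf e\in T}\rho^*_{\mathsf e}$ over the $^{\mathbf s}$OSTs $T$ of $G^{\mathrm D}$ whose unoriented version satisfies 1 and 2. Then $$Z^{\mathbf r}_{\mathrm{OST}}(\vec G,\rho)=Z^{\mathbf s}_{\mathrm{OST},(1,2)}(G^{\mathrm D},\rho^*).$$ -/

import Mathlib

namespace TreesDouble

open Equiv

/-! ### Multigraphs and oriented spanning trees -/

/-- A directed multigraph with vertex set `W` and set of oriented edges `E`. -/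
structure DirMultigraph (W E : Type*) where
  src : E → W
  tgt : E → W

namespace DirMultigraph

variable {W E : Type*}

/-- The edge set `T`, with orientations forgotten, contains a cycle: distinct vertices
`v 0, …, v n` and distinct edges `e 0, …, e n` of `T` such that `e i` joins `v i` and `v (i + 1)`
(indices modulo `n + 1`). Loops (`n = 0`) and pairs of parallel edges (`n = 1`) are cycles. -/
def HasCycle (Γ : DirMultigraph W E) (T : Finset E) : Prop :=
  ∃ (n : ℕ) (v : Fin (n + 1) → W) (e : Fin (n + 1) → E),
    Function.Injective v ∧ Function.Injective e ∧
      ∀ i, e i ∈ T ∧ s(Γ.src (e i), Γ.tgt (e i)) = s(v i, v (i + 1))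

/-- `T` is an `r`-rooted oriented spanning tree: it contains no cycle, and every vertex except
the root has an outgoing edge in `T`. -/
def IsOST (Γ : DirMultigraph W E) (r : W) (T : Finset E) : Prop :=
  ¬ Γ.HasCycle T ∧ ∀ x, x ≠ r → ∃ e ∈ T, Γ.src e = x

open Classical in
/-- The `r`-rooted OST partition function of `Γ` with weights `τ`. -/
noncomputable def ostPartition [Fintype E] (Γ : DirMultigraph W E) (r : W) (τ : E → ℂ) : ℂ :=
  ∑ T : Finset E with Γ.IsOST r T, ∏ e ∈ T, τ e

end DirMultigraph

/-- An undirected multigraph; the order of the two ends of an edge carries no meaning. -/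
structure Multigraph (W E : Type*) where
  fst : E → W
  snd : E → W

namespace Multigraph

variable {W E : Type*}

/-- The directed version: every edge `e` gives two opposite oriented edges, `(e, true)` from
`fst e` to `snd e` and `(e, false)` from `snd e` to `fst e`. -/
def directed (Γ : Multigraph W E) : DirMultigraph W (E × Bool) where
  src p := if p.2 then Γ.fst p.1 else Γ.snd p.1
  tgt p := if p.2 then Γ.snd p.1 else Γ.fst p.1

/-- The unoriented version of a set of oriented edges. -/
def unoriented (T : Finset (E × Bool)) : Set E := {e | ∃ b, (e, b) ∈ T}

open Classical in
/-- The partition function of the `r`-rooted OSTs of the undirected graph `Γ` whose unoriented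
version satisfies `P`; the weights `τ` are symmetric, that is, given on unoriented edges. -/
noncomputable def ostPartitionOn [Fintype E] (Γ : Multigraph W E) (r : W) (P : Set E → Prop)
    (τ : E → ℂ) : ℂ :=
  ∑ T : Finset (E × Bool) with Γ.directed.IsOST r T ∧ P (unoriented T), ∏ p ∈ T, τ p.1

end Multigraph

/-! ### Plane graphs -/

section

variable {V : Type*} {G : SimpleGraph V}

/-- The face permutation of a rotation system. The dart `d` is followed by the next dart on the
boundary of the face to its left: reverse `d`, then take the clockwise next dart around the
vertex that has been reached. -/
def facePerm (rot : Perm G.Dart) : Perm G.Dart :=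
  rot⁻¹ * SimpleGraph.Dart.symm_involutive.toPerm

/-- The faces of a rotation system are the cycles of its face permutation. -/
abbrev FaceOf (rot : Perm G.Dart) : Type _ := Quotient (Perm.SameCycle.setoid (facePerm rot))

end

/-- An embedding in the plane of a connected simple graph `G` with at least one edge, up to
orientation preserving homeomorphism: a rotation system (the counterclockwise cyclic order of the
darts around every vertex) of genus zero, with a choice of outer face. -/
structure PlaneEmbedding {V : Type*} (G : SimpleGraph V) where
  /-- The next dart in counterclockwise order around the origin of a dart. -/
  rot : Perm G.Dart
  rot_sameCycle : ∀ d d' : G.Dart, rot.SameCycle d d' ↔ d.fst = d'.fst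
  euler : Nat.card V + Nat.card (FaceOf rot) = Nat.card G.edgeSet + 2
  outer : FaceOf rot

namespace PlaneEmbedding

variable {V : Type*} {G : SimpleGraph V} (ε : PlaneEmbedding G)

/-- The face to the left of a dart. The corner of `d` is the angular sector between `d` and
`ε.rot d` around the origin of `d`; it lies in the face `ε.leftFace d`. -/
def leftFace (d : G.Dart) : FaceOf ε.rot := Quotient.mk _ d

/-- The darts with the outer face on their left. They index the sides of boundary edges on the
outer face, and also the corners of `G` in the outer face (the corner of `d` is at `d.fst`). -/
abbrev BdDart : Type _ := {d : G.Dart // ε.leftFace d = ε.outer}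

/-- The preceding dart on the boundary of the outer face: it ends at the origin of `c`. -/
def prevBd (c : ε.BdDart) : ε.BdDart :=
  ⟨(facePerm ε.rot)⁻¹ c.1, (Quotient.sound ⟨1, by simp⟩ : ε.leftFace _ = ε.leftFace c.1).trans c.2⟩

/-- The edge of `G` underlying a dart. -/
def edgeOf (d : G.Dart) : G.edgeSet := ⟨d.edge, d.edge_mem⟩

/-! ### The directed graph `GO`

The quadri-tiling graph has, for every dart `d` with underlying edge `e`, two vertices near the
half of `e` at the origin of `d`: a black one, `b d`, to the left of `d`, and a white one, `w d`,
to the right of `d`. Its edges are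
* `w d`—`b d`, crossing the half of the primal edge `e` at the origin of `d`;
* `w d.symm`—`b d`, crossing the half of the dual edge `e*` on the left of `d`;
* the external edges `b d`—`w (rot d)`, one for every corner of `G`.

The directed graph is obtained by orienting the first two kinds from white to black, merging
every external edge that is not on the outer face into one vertex, adding the root `r`, and adding
for every external edge `b c`—`w (rot c)` on the outer face two oriented edges, `(b c, w (rot c))`
and `(b c, r)`. -/

/-- Vertices of the directed graph. `corner d` is the vertex `b d`, merged with `w (rot d)` when the
corner of `d` is not in the outer face; `bdWhite c` is the unmerged vertex `w (rot c)`. -/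
inductive OVertex
  | corner (d : G.Dart)
  | bdWhite (c : ε.BdDart)
  | root

/-- Oriented edges of the directed graph. -/
inductive OEdge
  /-- From `w d` to `b d`, crossing the primal half-edge at the origin of `d`. -/
  | crossPrimal (d : G.Dart)
  /-- From `w d.symm` to `b d`, crossing the dual half-edge on the left of `d`. -/
  | crossDual (d : G.Dart)
  /-- From `b c` to `w (rot c)`, at an outer corner. -/
  | bdCorner (c : ε.BdDart)
  /-- From `b c` to the root, at an outer corner. -/
  | bdRoot (c : ε.BdDart)

open Classical in
/-- The vertex of the directed graph containing the white vertex `w d`; its corner is that of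
`rot⁻¹ d`. -/
noncomputable def whiteVertex (d : G.Dart) : ε.OVertex :=
  if h : ε.leftFace (ε.rot⁻¹ d) = ε.outer then .bdWhite ⟨ε.rot⁻¹ d, h⟩ else .corner (ε.rot⁻¹ d)

/-- The directed graph. -/
noncomputable def GO : DirMultigraph ε.OVertex ε.OEdge where
  src
    | .crossPrimal d => ε.whiteVertex d
    | .crossDual d => ε.whiteVertex d.symm
    | .bdCorner c => .corner c.1
    | .bdRoot c => .corner c.1
  tgt
    | .crossPrimal d => .corner d
    | .crossDual d => .corner d
    | .bdCorner c => .bdWhite c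
    | .bdRoot _ => .root

/-- The weights on the directed graph. -/
noncomputable def rho (θ : G.edgeSet → ℝ) (θb : ε.BdDart → ℝ) : ε.OEdge → ℂ
  | .crossPrimal d => Complex.I * Real.cos (θ (edgeOf d))
  | .crossDual d => Real.sin (θ (edgeOf d))
  | .bdCorner _ => 1
  | .bdRoot c => Complex.exp (-Complex.I * θb c) - 1

/-! ### The extended graph, the extended dual and the extended double graph -/

/-- Vertices of the extended dual: the inner faces, and the vertices into which the dual vertex of
the outer face is split, one for every side of a boundary edge on the outer face. -/
inductive DualVertex
  | inner (F : FaceOf ε.rot) (h : F ≠ ε.outer)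
  | split (c : ε.BdDart)

/-- Edges of the extended graph, which are also those of the extended dual: the edges of `G`, and
for every outer corner `c` an edge joining its vertex to `r`; the dual of the latter joins the
vertices `split (prevBd c)` and `split c`. -/
inductive ExtEdge
  | old (e : G.edgeSet)
  | bd (c : ε.BdDart)

/-- Darts of the extended graph: those of `G`, and for every outer corner `c` the darts
from `c.1.fst` to `r` and from `r` to `c.1.fst`. -/
inductive ExtDart
  | old (d : G.Dart)
  | toRoot (c : ε.BdDart)
  | fromRoot (c : ε.BdDart)

/-- The edge underlying a dart of the extended graph. -/
def extEdge : ε.ExtDart → ε.ExtEdge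
  | .old d => .old (edgeOf d)
  | .toRoot c => .bd c
  | .fromRoot c => .bd c

open Classical in
/-- The vertex of the extended dual to the left of a dart of the extended graph. Every edge `e` of
the extended graph has two darts; their left vertices are the two ends of the dual edge `e*`.
Looking from `c.1.fst` to `r` across the outer corner of `c`, the edge of `c` is on the right and
the edge of `prevBd c` is on the left. -/
noncomputable def extLeft : ε.ExtDart → ε.DualVertex
  | .old d => if h : ε.leftFace d = ε.outer then .split ⟨d, h⟩ else .inner (ε.leftFace d) h
  | .toRoot c => .split (ε.prevBd c)
  | .fromRoot c => .split c

/-- Vertices of the extended double graph: black vertices of primal type, black vertices of dual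
type, and a white vertex at the crossing of each edge of the extended graph with its dual. -/
inductive DVertex
  | primal (v : V)
  | dual (x : ε.DualVertex)
  | white (e : ε.ExtEdge)

/-- Edges of the extended double graph: the halves of the edges of the extended graph, except
those at `r`, and the halves of the edges of the extended dual. -/
inductive DEdge
  /-- The half of the edge of `d` at the origin of `d`. -/
  | primal (d : G.Dart)
  /-- The half, at the vertex `c.1.fst`, of the edge to `r` in the outer corner of `c`. -/
  | spoke (c : ε.BdDart)
  /-- The half, at the dual vertex on the left of `δ`, of the dual of the edge of `δ`. -/
  | dual (δ : ε.ExtDart)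

/-- The extended double graph; every edge joins a white and a black vertex. -/
noncomputable def GD : Multigraph ε.DVertex ε.DEdge where
  fst
    | .primal d => .white (.old (edgeOf d))
    | .spoke c => .white (.bd c)
    | .dual δ => .white (ε.extEdge δ)
  snd
    | .primal d => .primal d.fst
    | .spoke c => .primal c.1.fst
    | .dual δ => .dual (ε.extLeft δ)

/-- The dual weights on the extended double graph. -/
noncomputable def rhoStar (θ : G.edgeSet → ℝ) (θb : ε.BdDart → ℝ) : ε.DEdge → ℂ
  | .primal d => Real.sin (θ (edgeOf d))
  | .spoke c => Complex.exp (-Complex.I * θb c) - 1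
  | .dual (.old d) => Complex.I * Real.cos (θ (edgeOf d))
  | .dual (.toRoot _) => 1
  | .dual (.fromRoot _) => 1

/-- Local constraint at the non-boundary white vertices. For each of the two darts `d` of an edge
of `G`, exactly one of the following two consecutive half-edges at the white vertex is present: the
primal one at the origin of `d`, and the dual one on the right of `d`. Thus the configuration at the
white vertex is one of four: both primal halves; both dual halves; the primal half at the origin of
`d` and the dual half on the left of `d`, for one of the two darts `d`. -/
def PointOne (S : Set ε.DEdge) : Prop :=
  ∀ d : G.Dart, Xor (DEdge.primal d ∈ S) (DEdge.dual (.old d.symm) ∈ S)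

/-- Local constraint at the boundary white vertices, one for every outer corner `c`: the dual
half-edge at `split (prevBd c)` is present, and exactly one of the primal half-edge and
the dual half-edge at `split c` is present. -/
def PointTwo (S : Set ε.DEdge) : Prop :=
  ∀ c : ε.BdDart, DEdge.dual (.toRoot c) ∈ S ∧
    Xor (DEdge.spoke c ∈ S) (DEdge.dual (.fromRoot c) ∈ S)

/-! ### Finiteness of the edge sets -/

section Finiteness

variable [Fintype V]

noncomputable instance : Fintype ε.OEdge := by
  classical
  exact Fintype.ofSurjective
      (fun x : (G.Dart ⊕ G.Dart) ⊕ (ε.BdDart ⊕ ε.BdDart) =>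
        Sum.elim (Sum.elim OEdge.crossPrimal OEdge.crossDual)
          (Sum.elim OEdge.bdCorner OEdge.bdRoot) x)
      (by
        rintro (d | d | c | c)
        exacts [⟨.inl (.inl d), rfl⟩, ⟨.inl (.inr d), rfl⟩, ⟨.inr (.inl c), rfl⟩,
          ⟨.inr (.inr c), rfl⟩])

noncomputable instance : Fintype ε.DEdge := by
  classical
  exact Fintype.ofSurjective
      (fun x : (G.Dart ⊕ G.Dart) ⊕ (ε.BdDart ⊕ (ε.BdDart ⊕ ε.BdDart)) =>
        Sum.elim (Sum.elim DEdge.primal fun d => .dual (.old d))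
          (Sum.elim DEdge.spoke
            (Sum.elim (fun c => .dual (.toRoot c)) fun c => .dual (.fromRoot c))) x)
      (by
        rintro (d | c | (d | c | c))
        exacts [⟨.inl (.inl d), rfl⟩, ⟨.inr (.inl c), rfl⟩, ⟨.inl (.inr d), rfl⟩,
          ⟨.inr (.inr (.inl c)), rfl⟩, ⟨.inr (.inr (.inr c)), rfl⟩])

end Finiteness

end PlaneEmbedding

end TreesDouble

namespace TreesDouble

open Equiv

/-! ### Cycles and linear independence over the field with two elements -/

namespace DirMultigraph

variable {W E : Type*}

/-! Planar duality of spanning trees, carried out modulo two. The vertices of `GO` are the faces of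
the extended double graph, and every edge of `GO` crosses one half-edge (`crossed`). Adding the
edges across the halves of u_{i-1}u_i at u_{i-1} gives the full dual graph `dualGD`. A tree T of
`GO` is sent to the complement of the set of half-edges that it crosses, which is a spanning tree of
the extended double graph.

The two edges leaving a vertex of `GO` other than the root cross exactly the two half-edges compared
in constraint 1 or 2. Hence the constraints on the complement say that exactly one edge of T leaves
each such vertex (`isChoice_iff`). Of the two half-edges T crosses one; the other stays in the
complement, and its dual weight is the weight of the edge of T (`rhoStar_allowed`). The half-edges
that no edge of `GO` crosses have weight 1, so the products agree (`IsChoice.prod_rhoStar`).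

No topology is needed for the duality. Forests are the edge sets with independent incidence vectors
over the field with two elements; the two incidence matrices are orthogonal (`sum_inc_mul_inc`),
both graphs are connected, and the Euler relation fixes the cardinalities, so `IsIndep.compl`
applies. Finally, a spanning tree of an undirected graph has exactly one orientation towards a given
root (`ostPartitionOn_eq`), which is why s is arbitrary. -/

open Classical in
/-- The incidence matrix modulo two. -/
noncomputable def inc (Γ : DirMultigraph W E) (e : E) (x : W) : ZMod 2 :=
  (if Γ.src e = x then 1 else 0) + (if Γ.tgt e = x then 1 else 0)

/-- The incidence vectors of the edges in `T` are linearly independent modulo two. -/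
def IsIndep (Γ : DirMultigraph W E) (T : Finset E) : Prop :=
  ∀ z : E → ZMod 2, (∀ x, ∑ e ∈ T, z e * Γ.inc e x = 0) → ∀ e ∈ T, z e = 0

variable {Γ : DirMultigraph W E} {T : Finset E}

theorem IsIndep.mono {U : Finset E} (h : Γ.IsIndep T) (hU : U ⊆ T) : Γ.IsIndep U := by
  classical
  intro z hz e he
  have := h (fun e => if e ∈ U then z e else 0) (fun x => by
    refine Eq.trans ?_ (hz x)
    rw [← Finset.sum_subset hU]
    · exact Finset.sum_congr rfl fun e he => by simp [he]
    · intro e _ he; rw [if_neg he, zero_mul]) e (hU he)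
  simpa [he] using this

theorem inc_def [DecidableEq W] (e : E) (x : W) :
    Γ.inc e x = (if Γ.src e = x then 1 else 0) + (if Γ.tgt e = x then 1 else 0) := by
  unfold inc
  congr

theorem inc_of_ends [DecidableEq W] {e : E} {x y : W} (h : s(Γ.src e, Γ.tgt e) = s(x, y))
    (u : W) : Γ.inc e u = (if x = u then 1 else 0) + (if y = u then 1 else 0) := by
  rcases Sym2.eq_iff.1 h with ⟨h1, h2⟩ | ⟨h1, h2⟩
  · rw [inc_def, h1, h2]
  · rw [inc_def, h1, h2, add_comm]

theorem sum_inc_mul [Fintype W] (e : E) (g : W → ZMod 2) :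
    ∑ x, Γ.inc e x * g x = g (Γ.src e) + g (Γ.tgt e) := by
  classical
  simp [inc_def, add_mul, Finset.sum_add_distrib]

theorem sum_inc [Fintype W] (e : E) : ∑ x, Γ.inc e x = 0 := by
  simpa [CharTwo.add_self_eq_zero] using Γ.sum_inc_mul e (fun _ => 1)

theorem inc_ne_zero {e : E} {x : W} (h : Γ.inc e x ≠ 0) : Γ.src e = x ∨ Γ.tgt e = x := by
  by_contra! hc
  simp [inc, hc] at h

theorem hasCycle_of_loop {e : E} (he : e ∈ T) (h : Γ.src e = Γ.tgt e) : Γ.HasCycle T :=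
  ⟨0, fun _ => Γ.src e, fun _ => e, fun _ _ _ => Subsingleton.elim (α := Fin 1) _ _,
    fun _ _ _ => Subsingleton.elim (α := Fin 1) _ _, fun _ => ⟨he, by rw [← h]⟩⟩

/-- An infinite walk without backtracking in a finite graph contains a cycle. -/
theorem hasCycle_of_walk [Finite W] (w : ℕ → W) (e : ℕ → E) (hT : ∀ i, e i ∈ T)
    (hw : ∀ i, s(Γ.src (e i), Γ.tgt (e i)) = s(w i, w (i + 1)))
    (hne : ∀ i, e (i + 1) ≠ e i) : Γ.HasCycle T := by
  classical
  -- The least return time n + 1, over all starting points, makes the n + 1 vertices of the closed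
  -- walk distinct.
  have hex : ∃ n i, w i = w (i + (n + 1)) := by
    obtain ⟨i, j, hij, h⟩ := Finite.exists_ne_map_eq_of_infinite w
    rcases lt_or_gt_of_ne hij with h' | h'
    · exact ⟨j - i - 1, i, by rw [h]; congr 1; omega⟩
    · exact ⟨i - j - 1, j, by rw [← h]; congr 1; omega⟩
  obtain ⟨i, hi⟩ := Nat.find_spec hex
  have hmin := fun m => @Nat.find_min _ _ hex m
  set n := Nat.find hex
  have hinj : ∀ a b, a < b → b ≤ n → w (i + a) ≠ w (i + b) := by
    intro a b hab hb h
    refine hmin (b - a - 1) (by omega) ⟨i + a, ?_⟩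
    rw [h]; congr 1; omega
  have hsucc : ∀ k : Fin (n + 1), w (i + (k + 1 : Fin (n + 1))) = w (i + (k + 1 : ℕ)) := by
    intro k
    rcases eq_or_ne k (Fin.last n) with rfl | hk
    · simp [hi]
    · rw [Fin.val_add_one, if_neg hk]
  refine ⟨n, fun k => w (i + k), fun k => e (i + k), ?_, ?_, fun k => ⟨hT _, ?_⟩⟩
  · intro a b h
    rcases lt_trichotomy a b with hab | hab | hab
    · exact (hinj a b hab (by omega) h).elim
    · exact hab
    · exact (hinj b a hab (by omega) h.symm).elim
  -- A repeated edge has the same two ends, so either a vertex is repeated or b = a + 1 and the walk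
  -- backtracks.
  · have key : ∀ a b, a < b → b ≤ n → e (i + a) ≠ e (i + b) := by
      intro a b hab hb h
      have h1 := hw (i + a)
      rw [h, hw] at h1
      rcases Sym2.eq_iff.1 h1 with ⟨h2, -⟩ | ⟨h2, h3⟩
      · exact hinj a b hab hb h2.symm
      · rcases Nat.lt_or_ge (a + 1) b with hb' | hb'
        · exact hinj (a + 1) b hb' hb h2.symm
        · obtain rfl : b = a + 1 := by omega
          exact hne (i + a) h.symm
    intro a b h
    rcases lt_trichotomy a b with hab | hab | hab
    · exact (key a b hab (by omega) h).elim
    · exact hab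
    · exact (key b a hab (by omega) h.symm).elim
  · rw [hw]
    exact congrArg (fun y => s(w (i + k), y)) (hsucc k).symm

/-- Along a cycle every vertex is counted twice, so the incidence vectors of its edges sum to zero.
-/
theorem not_hasCycle_of_isIndep (h : Γ.IsIndep T) : ¬ Γ.HasCycle T := by
  classical
  rintro ⟨n, v, e, -, he, hT⟩
  have hsub : Finset.univ.map ⟨e, he⟩ ⊆ T := by
    intro x hx
    obtain ⟨i, -, rfl⟩ := Finset.mem_map.1 hx
    exact (hT i).1
  have := h.mono hsub (fun _ => 1) (fun x => by
    have hs : ∑ i, (if v (i + 1) = x then (1 : ZMod 2) else 0) = ∑ i, if v i = x then 1 else 0 :=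
      Equiv.sum_comp (Equiv.addRight (1 : Fin (n + 1)))
        (fun i => if v i = x then (1 : ZMod 2) else 0)
    simp only [Finset.sum_map, one_mul, Function.Embedding.coeFn_mk]
    rw [Finset.sum_congr rfl fun i _ => inc_of_ends (hT i).2 x, Finset.sum_add_distrib, hs,
      CharTwo.add_self_eq_zero]) (e 0) (by simp)
  exact one_ne_zero this

/-- In the support of a nontrivial relation no vertex has degree one, so a walk inside the support
can always go on without backtracking. -/
theorem isIndep_of_not_hasCycle [Finite W] (h : ¬ Γ.HasCycle T) : Γ.IsIndep T := by
  classical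
  intro z hz
  by_contra! hne
  obtain ⟨e₀, he₀, hze₀⟩ := hne
  apply h
  -- A state is the current vertex together with the edge of the support along which the walk is
  -- about to leave it.
  let State := {p : W × E // (p.2 ∈ T ∧ z p.2 ≠ 0) ∧ (Γ.src p.2 = p.1 ∨ Γ.tgt p.2 = p.1)}
  have step : ∀ p : State, ∃ q : State,
      s(Γ.src p.1.2, Γ.tgt p.1.2) = s(p.1.1, q.1.1) ∧ q.1.2 ≠ p.1.2 := by
    rintro ⟨⟨x, e⟩, ⟨he, hze⟩, hx⟩
    have hloop : Γ.src e ≠ Γ.tgt e := fun hl => h (hasCycle_of_loop he hl)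
    obtain ⟨y, hy⟩ : ∃ y, s(Γ.src e, Γ.tgt e) = s(x, y) := by
      change Γ.src e = x ∨ Γ.tgt e = x at hx
      rcases hx with hx | hx
      · exact ⟨Γ.tgt e, by rw [← hx]⟩
      · exact ⟨Γ.src e, by rw [← hx, Sym2.eq_swap]⟩
    have hxy : x ≠ y := by
      rintro rfl
      rcases Sym2.eq_iff.1 hy with ⟨h1, h2⟩ | ⟨h1, h2⟩ <;> exact hloop (h1.trans h2.symm)
    have hinc : Γ.inc e y = 1 := by simp [inc_of_ends hy, hxy]
    have hsum := hz y
    rw [← Finset.add_sum_erase _ _ he, hinc, mul_one] at hsum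
    obtain ⟨e', he', hne⟩ : ∃ e' ∈ T.erase e, z e' * Γ.inc e' y ≠ 0 := by
      by_contra! hc
      rw [Finset.sum_eq_zero hc, add_zero] at hsum
      exact hze hsum
    exact ⟨⟨⟨y, e'⟩, ⟨(Finset.mem_erase.1 he').2, left_ne_zero_of_mul hne⟩,
      inc_ne_zero (right_ne_zero_of_mul hne)⟩, hy, (Finset.mem_erase.1 he').1⟩
  choose f hf using step
  let p₀ : State := ⟨⟨Γ.src e₀, e₀⟩, ⟨he₀, hze₀⟩, Or.inl rfl⟩
  refine hasCycle_of_walk (fun i => (f^[i] p₀).1.1) (fun i => (f^[i] p₀).1.2)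
    (fun i => (f^[i] p₀).2.1.1) (fun i => ?_) fun i => ?_
  · rw [Function.iterate_succ_apply']
    exact (hf _).1
  · rw [Function.iterate_succ_apply']
    exact (hf _).2

/-! ### Forests and dimension: cardinality, duality and matchings -/

/-- A forest remains independent when the row of one vertex is deleted. -/
theorem IsIndep.eq_zero_of_sum_eq_zero [Fintype W] (h : Γ.IsIndep T) {X : Finset W} {x₀ : W}
    (hX : ∀ e ∈ T, Γ.src e ∈ X ∧ Γ.tgt e ∈ X) {z : E → ZMod 2}
    (hz : ∀ x ∈ X, x ≠ x₀ → ∑ e ∈ T, z e * Γ.inc e x = 0) : ∀ e ∈ T, z e = 0 := by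
  classical
  have hz' : ∀ x, x ≠ x₀ → ∑ e ∈ T, z e * Γ.inc e x = 0 := by
    intro x hx
    by_cases hxX : x ∈ X
    · exact hz x hxX hx
    · refine Finset.sum_eq_zero fun e he => ?_
      have h1 : Γ.src e ≠ x := fun h' => hxX (h' ▸ (hX e he).1)
      have h2 : Γ.tgt e ≠ x := fun h' => hxX (h' ▸ (hX e he).2)
      simp [inc, h1, h2]
  refine h z fun x => ?_
  rcases eq_or_ne x x₀ with rfl | hx
  -- Every edge has two ends, so the rows add up to zero and the equation at `x₀` follows from the
  -- others.
  · have htot : ∑ y, ∑ e ∈ T, z e * Γ.inc e y = 0 := by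
      rw [Finset.sum_comm]
      simp [← Finset.mul_sum, sum_inc]
    rwa [Finset.sum_eq_single x (fun y _ hy => hz' y hy) (by simp)] at htot
  · exact hz' x hx

/-- The incidence vectors remain independent with one coordinate of `X` dropped, so they live in
dimension `X.card - 1`. -/
theorem IsIndep.card_lt [Fintype W] (h : Γ.IsIndep T) {X : Finset W} (hne : X.Nonempty)
    (hX : ∀ e ∈ T, Γ.src e ∈ X ∧ Γ.tgt e ∈ X) : T.card < X.card := by
  classical
  obtain ⟨x₀, hx₀⟩ := hne
  let L : (T → ZMod 2) →ₗ[ZMod 2] (X.erase x₀ → ZMod 2) :=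
    { toFun := fun z x => ∑ e, z e * Γ.inc e x
      map_add' := fun a b => by ext x; simp [add_mul, Finset.sum_add_distrib]
      map_smul' := fun a b => by ext x; simp [Finset.mul_sum, mul_assoc] }
  have hL : Function.Injective L := by
    rw [injective_iff_map_eq_zero]
    intro z hz
    have hval : ∀ e : T, Function.extend Subtype.val z 0 (e : E) = z e :=
      fun e => Subtype.val_injective.extend_apply _ _ e
    have := h.eq_zero_of_sum_eq_zero (x₀ := x₀) hX (z := Function.extend Subtype.val z 0)
      (fun x hx hne => by
        rw [← Finset.sum_coe_sort]
        simp only [hval]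
        exact congrFun hz ⟨x, Finset.mem_erase.2 ⟨hne, hx⟩⟩)
    ext e
    rw [← hval, this e e.2]; rfl
  have := LinearMap.finrank_le_finrank_of_injective hL
  simp only [Module.finrank_fintype_fun_eq_card, Fintype.card_coe] at this
  rw [Finset.card_erase_of_mem hx₀] at this
  have := Finset.card_pos.2 ⟨x₀, hx₀⟩
  omega

/-- An oriented spanning tree has exactly one edge out of every vertex except the root. -/
theorem IsOST.out [Fintype W] {r : W} (h : Γ.IsOST r T) :
    T.card + 1 = Fintype.card W ∧ Set.InjOn Γ.src T ∧ ∀ e ∈ T, Γ.src e ≠ r := by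
  classical
  have hlt := (isIndep_of_not_hasCycle h.1).card_lt (X := Finset.univ) ⟨r, by simp⟩ (by simp)
  have hsub : Finset.univ.erase r ⊆ T.image Γ.src := by
    intro x hx
    obtain ⟨e, he, rfl⟩ := h.2 x (Finset.ne_of_mem_erase hx)
    exact Finset.mem_image_of_mem _ he
  -- The forest bound and the supply of outgoing edges squeeze `T.card` to one value, which forces
  -- both inequalities to be equalities.
  have h1 := Finset.card_le_card hsub
  have h2 : (T.image Γ.src).card ≤ T.card := Finset.card_image_le
  rw [Finset.card_erase_of_mem (Finset.mem_univ r)] at h1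
  rw [Finset.card_univ] at hlt h1
  refine ⟨by omega, Finset.card_image_iff.1 (by omega), fun e he => ?_⟩
  have heq := Finset.eq_of_subset_of_card_le hsub (by
    rw [Finset.card_erase_of_mem (Finset.mem_univ r), Finset.card_univ]; omega)
  have : Γ.src e ∈ Finset.univ.erase r := heq ▸ Finset.mem_image_of_mem _ he
  exact Finset.ne_of_mem_erase this

/-- Two graphs on the same edges with orthogonal incidence matrices, the first one connected: the
complement of a forest of the second one is independent in the first one, if its cardinality is
that of a spanning tree. -/
theorem IsIndep.compl {F : Type*} [Fintype W] [Fintype F] [Fintype E] [DecidableEq E]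
    {Δ : DirMultigraph F E} (horth : ∀ x f, ∑ e, Γ.inc e x * Δ.inc e f = 0)
    (hconn : ∀ g : W → ZMod 2, (∀ e, g (Γ.src e) = g (Γ.tgt e)) → ∀ x y, g x = g y)
    (hT : Δ.IsIndep T) (hcard : Tᶜ.card + 1 = Fintype.card W) : Γ.IsIndep Tᶜ := by
  classical
  obtain ⟨x₀⟩ : Nonempty W := Fintype.card_pos_iff.1 (by omega)
  -- The coboundary of a potential vanishing at `x₀`, restricted to the complement of `T`.
  let L : ({x // x ≠ x₀} → ZMod 2) →ₗ[ZMod 2] (↥(Tᶜ) → ZMod 2) :=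
    { toFun := fun g e => ∑ x : {x // x ≠ x₀}, Γ.inc e x * g x
      map_add' := fun a b => by ext x; simp [mul_add, Finset.sum_add_distrib]
      map_smul' := fun a b => by ext x; simp [Finset.mul_sum, mul_left_comm] }
  have hext : ∀ (g : {x // x ≠ x₀} → ZMod 2) (e : E), ∑ x, Γ.inc e x.1 * g x =
      ∑ x, Γ.inc e x * Function.extend Subtype.val g 0 x := by
    intro g e
    have h0 : Function.extend Subtype.val g 0 x₀ = 0 :=
      Function.extend_apply' _ _ _ (by rintro ⟨⟨a, ha⟩, h⟩; exact ha h)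
    rw [← Finset.sum_erase (a := x₀) Finset.univ (by rw [h0, mul_zero]),
      Finset.sum_subtype (p := fun x => x ≠ x₀) (Finset.univ.erase x₀) (by simp)]
    exact Finset.sum_congr rfl fun x _ => by rw [Subtype.val_injective.extend_apply]
  have hinj : Function.Injective L := by
    rw [injective_iff_map_eq_zero]
    intro g hg
    set g' : W → ZMod 2 := Function.extend Subtype.val g 0 with hg'
    have hS : ∀ e ∉ T, ∑ x, Γ.inc e x * g' x = 0 := by
      intro e he
      rw [← hext]
      exact congrFun hg ⟨e, Finset.mem_compl.2 he⟩
    -- By orthogonality a coboundary of `Γ` is a relation among the incidence vectors of `Δ`. This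
    -- one is supported on the forest `T`, so it vanishes, and connectedness makes the potential
    -- constant.
    have hTz := hT (fun e => ∑ x, Γ.inc e x * g' x) (fun f => by
      rw [Finset.sum_subset (Finset.subset_univ T) (fun e _ he => by rw [hS e he, zero_mul])]
      simp only [Finset.sum_mul]
      rw [Finset.sum_comm]
      refine Finset.sum_eq_zero fun x _ => ?_
      rw [← mul_zero (g' x), ← horth x f, Finset.mul_sum]
      exact Finset.sum_congr rfl fun e _ => by ring)
    have hall : ∀ e, g' (Γ.src e) = g' (Γ.tgt e) := by
      intro e
      rw [← CharTwo.add_eq_zero, ← sum_inc_mul]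
      by_cases he : e ∈ T
      exacts [hTz e he, hS e he]
    ext x
    rw [← Subtype.val_injective.extend_apply g 0 x]
    refine (hconn g' hall x x₀).trans ?_
    exact Function.extend_apply' _ _ _ (by rintro ⟨⟨a, ha⟩, h⟩; exact ha h)
  have hsurj : Function.Surjective L := by
    refine (LinearMap.injective_iff_surjective_of_finrank_eq_finrank ?_).1 hinj
    simp only [Module.finrank_fintype_fun_eq_card, Fintype.card_coe]
    rw [Fintype.card_subtype_compl, Fintype.card_subtype_eq]
    omega
  intro z hz e he
  -- A coboundary that meets the complement of `T` only in `e`: pairing it with the relation `z`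
  -- gives both `z e` and zero.
  obtain ⟨g, hg⟩ := hsurj (Pi.single ⟨e, he⟩ 1)
  have h1 : ∑ e' : ↥(Tᶜ), z e' * L g e' = z e := by
    rw [hg, Finset.sum_eq_single ⟨e, he⟩] <;> simp +contextual
  rw [← h1]
  simp only [L, LinearMap.coe_mk, AddHom.coe_mk, Finset.mul_sum]
  rw [Finset.sum_comm]
  refine Finset.sum_eq_zero fun x _ => ?_
  refine Eq.trans ?_ ((congrArg (g x * ·) (hz x)).trans (mul_zero _))
  rw [← Finset.sum_coe_sort Tᶜ, Finset.mul_sum]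
  exact Finset.sum_congr rfl fun e _ => by ring

/-- The edges of a spanning tree can be matched with the vertices other than a root. -/
theorem IsIndep.exists_matching [Fintype W] (h : Γ.IsIndep T)
    (hcard : T.card + 1 = Fintype.card W) (r : W) :
    ∃ f : {x // x ≠ r} ≃ T, ∀ x, Γ.src (f x) = x ∨ Γ.tgt (f x) = x := by
  classical
  have hc : Fintype.card {x // x ≠ r} = Fintype.card T := by
    rw [Fintype.card_subtype_compl, Fintype.card_subtype_eq, Fintype.card_coe]
    omega
  let ι := Fintype.equivOfCardEq hc
  let M : Matrix {x // x ≠ r} {x // x ≠ r} (ZMod 2) := fun x y => Γ.inc (ι y) x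
  -- The incidence matrix without the row of `r` is invertible. A nonzero term of the Leibniz
  -- expansion is a permutation pairing each edge with one of its ends.
  have hM : M.det ≠ 0 := by
    rw [← isUnit_iff_ne_zero, ← Matrix.isUnit_iff_isUnit_det, ← Matrix.mulVec_injective_iff_isUnit]
    change Function.Injective M.mulVecLin
    rw [injective_iff_map_eq_zero]
    intro g hg
    let z : E → ZMod 2 := Function.extend Subtype.val (g ∘ ι.symm) 0
    have hval : ∀ e : T, z e = g (ι.symm e) :=
      fun e => Subtype.val_injective.extend_apply _ _ e
    have hz := h.eq_zero_of_sum_eq_zero (X := Finset.univ) (x₀ := r) (by simp) (z := z)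
      (fun x _ hx => by
        refine Eq.trans ?_ (show _ = (0 : ZMod 2) from congrFun hg ⟨x, hx⟩)
        rw [← Finset.sum_coe_sort, ← ι.sum_comp]
        simp only [hval, Equiv.symm_apply_apply]
        exact Finset.sum_congr rfl fun y _ => mul_comm _ _)
    ext x
    have := hval (ι x)
    rw [hz _ (ι x).2, ι.symm_apply_apply] at this
    exact this.symm
  rw [Matrix.det_apply] at hM
  obtain ⟨σ, -, hσ⟩ := Finset.exists_ne_zero_of_sum_ne_zero hM
  have hσ' : ∏ i, M (σ i) i ≠ 0 := fun h0 => hσ (by rw [h0, smul_zero])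
  refine ⟨σ.symm.trans ι, fun x => inc_ne_zero ?_⟩
  have := Finset.prod_ne_zero_iff.1 hσ' (σ.symm x) (Finset.mem_univ _)
  rwa [σ.apply_symm_apply] at this

end DirMultigraph

/-! ### Oriented spanning trees of undirected graphs -/

namespace Multigraph

open DirMultigraph

variable {W E : Type*}

/-- Every edge oriented from its first end to its second end. -/
def toDir (Γ : Multigraph W E) : DirMultigraph W E := ⟨Γ.fst, Γ.snd⟩

variable {Γ : Multigraph W E}

theorem inc_directed (p : E × Bool) (x : W) : Γ.directed.inc p x = Γ.toDir.inc p.1 x := by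
  classical
  rcases p with ⟨e, _ | _⟩ <;> simp [inc_def, directed, toDir, add_comm]

/-- The two orientations of an edge have the same incidence vector, so they cannot both occur. -/
theorem injOn_fst_of_isIndep {T : Finset (E × Bool)} (h : Γ.directed.IsIndep T) :
    Set.InjOn Prod.fst (T : Set (E × Bool)) := by
  classical
  rintro p hp q hq hpq
  by_contra hne
  have hsub : {p, q} ⊆ T := by
    intro a ha
    rcases Finset.mem_insert.1 ha with rfl | ha
    exacts [hp, Finset.mem_singleton.1 ha ▸ hq]
  refine one_ne_zero (h.mono hsub (fun _ => 1) (fun x => ?_) p (by simp))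
  rw [Finset.sum_pair hne, inc_directed, inc_directed, hpq, CharTwo.add_self_eq_zero]

theorem isIndep_directed_iff [DecidableEq E] {T : Finset (E × Bool)} :
    Γ.directed.IsIndep T ↔
      Set.InjOn Prod.fst (T : Set (E × Bool)) ∧ Γ.toDir.IsIndep (T.image Prod.fst) := by
  refine ⟨fun h => ⟨injOn_fst_of_isIndep h, fun z hz e he => ?_⟩, fun ⟨hinj, h⟩ z hz p hp => ?_⟩
  · obtain ⟨p, hp, rfl⟩ := Finset.mem_image.1 he
    refine h (z ∘ Prod.fst) (fun x => ?_) p hp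
    rw [← hz x, Finset.sum_image (injOn_fst_of_isIndep h)]
    exact Finset.sum_congr rfl fun q _ => by rw [inc_directed]; rfl
  · classical
    let z' : E → ZMod 2 := fun e => ∑ q ∈ T with q.1 = e, z q
    have hz' : ∀ q ∈ T, z' q.1 = z q := by
      intro q hq
      refine Finset.sum_eq_single_of_mem q (by simp [hq]) fun a ha hne => ?_
      rw [Finset.mem_filter] at ha
      exact (hne (hinj ha.1 hq ha.2)).elim
    rw [← hz' p hp]
    refine h z' (fun x => ?_) _ (Finset.mem_image_of_mem _ hp)
    rw [← hz x, Finset.sum_image hinj]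
    exact Finset.sum_congr rfl fun q hq => by rw [inc_directed, hz' q hq]

theorem coe_image_fst [DecidableEq E] (T : Finset (E × Bool)) :
    ((T.image Prod.fst : Finset E) : Set E) = unoriented T := by
  ext e
  simp [unoriented]

/-- Each edge is oriented away from the vertex with which it is matched. -/
theorem exists_isOST_of_isIndep [Fintype W] [DecidableEq E] {S : Finset E}
    (h : Γ.toDir.IsIndep S) (hcard : S.card + 1 = Fintype.card W) (r : W) :
    ∃ T, Γ.directed.IsOST r T ∧ T.image Prod.fst = S := by
  classical
  obtain ⟨f, hf⟩ := h.exists_matching hcard r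
  let o : {x // x ≠ r} → E × Bool := fun x => (f x, decide (Γ.fst (f x) = x))
  have himg : (Finset.univ.image o).image Prod.fst = S := by
    ext e
    simp only [Finset.mem_image, Finset.mem_univ, true_and, exists_exists_eq_and, o]
    exact ⟨fun ⟨x, hx⟩ => hx ▸ (f x).2, fun he => ⟨f.symm ⟨e, he⟩, by simp⟩⟩
  refine ⟨Finset.univ.image o, ⟨not_hasCycle_of_isIndep (isIndep_directed_iff.2 ⟨?_, himg ▸ h⟩),
    fun x hx => ⟨o ⟨x, hx⟩, by simp, ?_⟩⟩, himg⟩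
  · intro p hp q hq hpq
    simp only [Finset.coe_image, Finset.coe_univ, Set.image_univ, Set.mem_range] at hp hq
    obtain ⟨x, rfl⟩ := hp
    obtain ⟨y, rfl⟩ := hq
    rw [f.injective (Subtype.ext hpq)]
  · have := hf ⟨x, hx⟩
    by_cases hfx : Γ.fst (f ⟨x, hx⟩) = x
    · simp [directed, o, hfx]
    · simpa [directed, o, hfx, toDir] using this

/-- Uniqueness of the orientation. From the target of an edge of `T \ T'` leaves another edge of `T
\ T'`, so this forest has all its ends among its sources: at most as many vertices as edges, against
`IsIndep.card_lt`. -/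
theorem subset_of_isOST [Fintype W] [DecidableEq E] {r : W} {T T' : Finset (E × Bool)}
    (h : Γ.directed.IsOST r T) (h' : Γ.directed.IsOST r T')
    (heq : T.image Prod.fst = T'.image Prod.fst) : T ⊆ T' := by
  classical
  by_contra hsub
  have hind := isIndep_of_not_hasCycle h.1
  have hinj := injOn_fst_of_isIndep hind
  obtain ⟨-, hout, hroot⟩ := h'.out
  have hbad : (T \ T').Nonempty := Finset.sdiff_nonempty.2 hsub
  have hlt := (hind.mono (U := T \ T') Finset.sdiff_subset).card_lt
    (X := (T \ T').image Γ.directed.src) (hbad.image _) (by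
      intro p hp
      refine ⟨Finset.mem_image_of_mem _ hp, ?_⟩
      obtain ⟨hpT, hpT'⟩ := Finset.mem_sdiff.1 hp
      have hrev : (p.1, !p.2) ∈ T' := by
        have : p.1 ∈ T'.image Prod.fst := heq ▸ Finset.mem_image_of_mem _ hpT
        obtain ⟨q, hq, hqp⟩ := Finset.mem_image.1 this
        have : q.2 ≠ p.2 := fun h2 => hpT' (Prod.ext hqp h2 ▸ hq)
        have : q = (p.1, !p.2) := Prod.ext hqp (by revert this; cases q.2 <;> cases p.2 <;> simp)
        exact this ▸ hq
      have hsrc : Γ.directed.src (p.1, !p.2) = Γ.directed.tgt p := by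
        rcases p with ⟨e, _ | _⟩ <;> simp [directed]
      obtain ⟨q, hq, hqs⟩ := h.2 (Γ.directed.tgt p) (hsrc ▸ hroot _ hrev)
      refine Finset.mem_image.2 ⟨q, Finset.mem_sdiff.2 ⟨hq, fun hq' => ?_⟩, hqs⟩
      obtain rfl := hout hq' hrev (hqs.trans hsrc.symm)
      have := congrArg Prod.snd (hinj hq hpT rfl)
      simp at this)
  exact absurd Finset.card_image_le hlt.not_ge

open Classical in
/-- Summing over the oriented spanning trees of an undirected graph amounts to summing over its
spanning trees. -/
theorem ostPartitionOn_eq [Fintype W] [Fintype E] (r : W) (P : Set E → Prop) (τ : E → ℂ) :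
    Γ.ostPartitionOn r P τ =
      ∑ S : Finset E with (Γ.toDir.IsIndep S ∧ S.card + 1 = Fintype.card W) ∧ P S,
        ∏ e ∈ S, τ e := by
  refine Finset.sum_bij (fun T _ => T.image Prod.fst) ?_ ?_ ?_ ?_
  · intro T hT
    obtain ⟨hT, hP⟩ := (Finset.mem_filter.1 hT).2
    have hind := isIndep_directed_iff.1 (isIndep_of_not_hasCycle hT.1)
    simp only [Finset.mem_filter, Finset.mem_univ, true_and, coe_image_fst, hP, and_true]
    exact ⟨hind.2, by rw [Finset.card_image_of_injOn hind.1]; exact hT.out.1⟩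
  · intro T hT T' hT' heq
    have hT := (Finset.mem_filter.1 hT).2.1
    have hT' := (Finset.mem_filter.1 hT').2.1
    exact (subset_of_isOST hT hT' heq).antisymm (subset_of_isOST hT' hT heq.symm)
  · intro S hS
    obtain ⟨⟨hS, hcard⟩, hP⟩ := (Finset.mem_filter.1 hS).2
    obtain ⟨T, hT, rfl⟩ := exists_isOST_of_isIndep hS hcard r
    exact ⟨T, by simpa [← coe_image_fst, hT] using hP, rfl⟩
  · intro T hT
    have hT := (Finset.mem_filter.1 hT).2.1
    rw [Finset.prod_image (injOn_fst_of_isIndep (isIndep_of_not_hasCycle hT.1))]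

end Multigraph

namespace PlaneEmbedding

open DirMultigraph

variable {V : Type*} {G : SimpleGraph V} (ε : PlaneEmbedding G)

/-! ### Rotations and faces -/

theorem fst_rot (d : G.Dart) : (ε.rot d).fst = d.fst :=
  ((ε.rot_sameCycle d (ε.rot d)).1 ⟨1, by simp⟩).symm

theorem facePerm_apply (d : G.Dart) : facePerm ε.rot d = ε.rot⁻¹ d.symm := rfl

theorem leftFace_facePerm (d : G.Dart) : ε.leftFace (facePerm ε.rot d) = ε.leftFace d :=
  (Quotient.sound ⟨1, by simp⟩ : ε.leftFace d = ε.leftFace _).symm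

theorem edgeOf_symm (d : G.Dart) : edgeOf d.symm = edgeOf d :=
  Subtype.ext d.edge_symm

/-- The following dart on the boundary of the outer face. -/
def nextBd (c : ε.BdDart) : ε.BdDart :=
  ⟨facePerm ε.rot c.1, (ε.leftFace_facePerm c.1).trans c.2⟩

theorem prevBd_eq_iff (c c' : ε.BdDart) : ε.prevBd c' = c ↔ c' = ε.nextBd c := by
  rw [Subtype.ext_iff, Subtype.ext_iff]
  exact Perm.inv_eq_iff_eq

theorem whiteVertex_of_outer {d : G.Dart} (h : ε.leftFace (ε.rot⁻¹ d) = ε.outer) :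
    ε.whiteVertex d = .bdWhite ⟨ε.rot⁻¹ d, h⟩ := dif_pos h

theorem whiteVertex_of_inner {d : G.Dart} (h : ε.leftFace (ε.rot⁻¹ d) ≠ ε.outer) :
    ε.whiteVertex d = .corner (ε.rot⁻¹ d) := dif_neg h

theorem whiteVertex_injective : Function.Injective ε.whiteVertex := by
  intro d d' h
  apply ε.rot⁻¹.injective
  by_cases h1 : ε.leftFace (ε.rot⁻¹ d) = ε.outer <;>
    by_cases h2 : ε.leftFace (ε.rot⁻¹ d') = ε.outer
  · rw [whiteVertex_of_outer _ h1, whiteVertex_of_outer _ h2] at h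
    simpa using h
  · rw [whiteVertex_of_outer _ h1, whiteVertex_of_inner _ h2] at h
    cases h
  · rw [whiteVertex_of_inner _ h1, whiteVertex_of_outer _ h2] at h
    cases h
  · rw [whiteVertex_of_inner _ h1, whiteVertex_of_inner _ h2] at h
    simpa using h

theorem whiteVertex_ne_root (d : G.Dart) : ε.whiteVertex d ≠ .root := by
  unfold whiteVertex
  split <;> simp

theorem whiteVertex_ne_corner (d : G.Dart) (c : ε.BdDart) : ε.whiteVertex d ≠ .corner c.1 := by
  by_cases h : ε.leftFace (ε.rot⁻¹ d) = ε.outer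
  · rw [whiteVertex_of_outer _ h]; simp
  · rw [whiteVertex_of_inner _ h]
    rintro h'
    rw [OVertex.corner.inj h'] at h
    exact h c.2

/-- A vertex of the directed graph is the root, an unmerged black vertex, or contains a white
vertex of the quadri-tiling graph. -/
theorem OVertex.exists_eq (x : ε.OVertex) :
    x = .root ∨ (∃ c : ε.BdDart, x = .corner c.1) ∨ ∃ d, x = ε.whiteVertex d := by
  rcases x with d | c | _
  · by_cases h : ε.leftFace d = ε.outer
    · exact Or.inr (Or.inl ⟨⟨d, h⟩, rfl⟩)
    · exact Or.inr (Or.inr ⟨ε.rot d, by rw [whiteVertex_of_inner] <;> simp [h]⟩)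
  · exact Or.inr (Or.inr ⟨ε.rot c.1, by rw [whiteVertex_of_outer] <;> simp [c.2]⟩)
  · exact Or.inl rfl

open Classical in
theorem extLeft_old (d : G.Dart) : ε.extLeft (.old d) =
    if h : ε.leftFace d = ε.outer then .split ⟨d, h⟩ else .inner (ε.leftFace d) h := rfl

theorem extLeft_old_eq_inner_iff (d : G.Dart) (F : FaceOf ε.rot) (hF : F ≠ ε.outer) :
    ε.extLeft (.old d) = .inner F hF ↔ ε.leftFace d = F := by
  rw [extLeft_old]
  split
  · next h => simp [h, hF.symm]
  · simp

theorem extLeft_old_eq_split_iff (d : G.Dart) (c : ε.BdDart) :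
    ε.extLeft (.old d) = .split c ↔ d = c.1 := by
  rw [extLeft_old]
  split
  · simp [Subtype.ext_iff]
  · next h => simpa using fun h' : d = c.1 => h (h' ▸ c.2)

/-! ### The dual of the extended double graph -/

/-- The dual of the extended double graph: an edge joins the two faces that are separated by an
edge of the extended double graph. -/
noncomputable def dualGD : DirMultigraph ε.OVertex ε.DEdge where
  src
    | .primal d => ε.whiteVertex d
    | .spoke c => .corner c.1
    | .dual (.old d) => ε.whiteVertex d.symm
    | .dual (.toRoot c) => .bdWhite c
    | .dual (.fromRoot c) => .corner c.1
  tgt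
    | .primal d => .corner d
    | .spoke c => .bdWhite c
    | .dual (.old d) => .corner d
    | .dual (.toRoot _) => .root
    | .dual (.fromRoot _) => .root

/-- The edge of the extended double graph crossed by an edge of the directed graph. -/
def crossed : ε.OEdge ↪ ε.DEdge where
  toFun
    | .crossPrimal d => .primal d
    | .crossDual d => .dual (.old d)
    | .bdCorner c => .spoke c
    | .bdRoot c => .dual (.fromRoot c)
  inj' := by
    rintro (d | d | c | c) (d' | d' | c' | c') h <;> simp_all

theorem src_crossed (e : ε.OEdge) : ε.dualGD.src (ε.crossed e) = ε.GO.src e := by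
  cases e <;> rfl

theorem tgt_crossed (e : ε.OEdge) : ε.dualGD.tgt (ε.crossed e) = ε.GO.tgt e := by
  cases e <;> rfl

theorem inc_crossed (e : ε.OEdge) (x : ε.OVertex) :
    ε.dualGD.inc (ε.crossed e) x = ε.GO.inc e x := by
  unfold inc
  rw [src_crossed, tgt_crossed]

theorem isIndep_map_crossed {T : Finset ε.OEdge} :
    ε.dualGD.IsIndep (T.map ε.crossed) ↔ ε.GO.IsIndep T := by
  simp only [IsIndep, Finset.sum_map, inc_crossed, Finset.forall_mem_map]
  refine ⟨fun h z hz => ?_, fun h z hz => h (fun e => z (ε.crossed e)) hz⟩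
  have hval : ∀ e, Function.extend ε.crossed z 0 (ε.crossed e) = z e :=
    fun e => ε.crossed.injective.extend_apply _ _ e
  simpa only [hval] using h (Function.extend ε.crossed z 0) (by simpa only [hval] using hz)

/-! ### Finiteness and the Euler relation -/

/-- Edges of the extended double graph, by type. -/
def dEdgeEquiv : (G.Dart ⊕ G.Dart) ⊕ (ε.BdDart ⊕ ε.BdDart ⊕ ε.BdDart) ≃ ε.DEdge where
  toFun := Sum.elim (Sum.elim .primal fun d => .dual (.old d))
    (Sum.elim .spoke (Sum.elim (fun c => .dual (.toRoot c)) fun c => .dual (.fromRoot c)))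
  invFun
    | .primal d => .inl (.inl d)
    | .dual (.old d) => .inl (.inr d)
    | .spoke c => .inr (.inl c)
    | .dual (.toRoot c) => .inr (.inr (.inl c))
    | .dual (.fromRoot c) => .inr (.inr (.inr c))
  left_inv := by rintro ((d | d) | (c | c | c)) <;> rfl
  right_inv := by rintro (d | c | (d | c | c)) <;> rfl

/-- Vertices of the directed graph, by type. -/
def oVertexEquiv : G.Dart ⊕ ε.BdDart ⊕ Unit ≃ ε.OVertex where
  toFun := Sum.elim .corner (Sum.elim .bdWhite fun _ => .root)
  invFun
    | .corner d => .inl d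
    | .bdWhite c => .inr (.inl c)
    | .root => .inr (.inr ())
  left_inv := by rintro (d | c | _) <;> rfl
  right_inv := by rintro (d | c | _) <;> rfl

/-- Vertices of the extended double graph, by type. -/
def dVertexEquiv :
    V ⊕ ({F : FaceOf ε.rot // F ≠ ε.outer} ⊕ ε.BdDart) ⊕ (G.edgeSet ⊕ ε.BdDart) ≃ ε.DVertex where
  toFun := Sum.elim .primal (Sum.elim
    (Sum.elim (fun F => .dual (.inner F.1 F.2)) fun c => .dual (.split c))
    (Sum.elim (fun e => .white (.old e)) fun c => .white (.bd c)))
  invFun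
    | .primal v => .inl v
    | .dual (.inner F h) => .inr (.inl (.inl ⟨F, h⟩))
    | .dual (.split c) => .inr (.inl (.inr c))
    | .white (.old e) => .inr (.inr (.inl e))
    | .white (.bd c) => .inr (.inr (.inr c))
  left_inv := by rintro (v | (F | c) | (e | c)) <;> rfl
  right_inv := by rintro (v | (F | c) | (e | c)) <;> rfl

section Finiteness

variable [Fintype V]

instance finite_dart : Finite G.Dart := by
  classical
  infer_instance

noncomputable instance : Fintype ε.OVertex := by
  have := Fintype.ofFinite (G.Dart ⊕ ε.BdDart ⊕ Unit)
  exact Fintype.ofEquiv _ ε.oVertexEquiv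

noncomputable instance : Fintype ε.DVertex := by
  have : Finite (FaceOf ε.rot) := Quotient.finite _
  have := Fintype.ofFinite
    (V ⊕ ({F : FaceOf ε.rot // F ≠ ε.outer} ⊕ ε.BdDart) ⊕ (G.edgeSet ⊕ ε.BdDart))
  exact Fintype.ofEquiv _ ε.dVertexEquiv

theorem natCard_dart : Nat.card G.Dart = 2 * Nat.card G.edgeSet := by
  classical
  rw [Nat.card_eq_fintype_card, G.dart_card_eq_twice_card_edges, Nat.card_eq_fintype_card,
    SimpleGraph.edgeFinset_card]

/-- The Euler relation of the extended double graph. -/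
theorem card_dVertex_add_card_oVertex :
    Fintype.card ε.DVertex + Fintype.card ε.OVertex = Fintype.card ε.DEdge + 2 := by
  have : Finite (FaceOf ε.rot) := Quotient.finite _
  have hF : Nat.card {F : FaceOf ε.rot // F ≠ ε.outer} + 1 = Nat.card (FaceOf ε.rot) := by
    classical
    have := Fintype.ofFinite (FaceOf ε.rot)
    have hpos : 0 < Fintype.card (FaceOf ε.rot) := Fintype.card_pos_iff.2 ⟨ε.outer⟩
    rw [Nat.card_eq_fintype_card, Nat.card_eq_fintype_card, Fintype.card_subtype_compl,
      Fintype.card_subtype_eq]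
    omega
  -- With n outer corners, the three cardinalities are V + (F - 1) + E + 2n, 2E + n + 1 and 4E + 3n.
  have he := ε.euler
  have hd := natCard_dart (G := G)
  rw [← Nat.card_eq_fintype_card, ← Nat.card_eq_fintype_card, ← Nat.card_eq_fintype_card,
    ← Nat.card_congr ε.dEdgeEquiv, ← Nat.card_congr ε.oVertexEquiv,
    ← Nat.card_congr ε.dVertexEquiv]
  simp only [Nat.card_sum, Nat.card_unique]
  omega

theorem sum_dEdge [Fintype G.Dart] [Fintype ε.BdDart] {M : Type*} [AddCommMonoid M]
    (f : ε.DEdge → M) :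
    ∑ e, f e = (∑ d, f (.primal d) + ∑ d, f (.dual (.old d))) +
      (∑ c, f (.spoke c) + (∑ c, f (.dual (.toRoot c)) + ∑ c, f (.dual (.fromRoot c)))) := by
  rw [← ε.dEdgeEquiv.sum_comp]
  simp only [Fintype.sum_sum_type]
  rfl

/-! ### Orthogonality and connectedness -/

/-- The boundary of every face of the extended double graph is a cycle. -/
theorem sum_inc_mul_inc (x : ε.DVertex) (y : ε.OVertex) :
    ∑ e, ε.GD.toDir.inc e x * ε.dualGD.inc e y = 0 := by
  classical
  have := Fintype.ofFinite G.Dart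
  have := Fintype.ofFinite ε.BdDart
  obtain ⟨φ, hφ⟩ : ∃ φ : ε.OVertex → ZMod 2,
      -- The indicator of `y` is hidden behind an arbitrary potential `φ`, whose differences
      -- telescope around each `x`.
      ∀ e, ε.dualGD.inc e y = φ (ε.dualGD.src e) + φ (ε.dualGD.tgt e) :=
    ⟨fun z => if z = y then 1 else 0, fun e => inc_def e y⟩
  simp only [hφ, inc_def, sum_dEdge]
  simp only [Multigraph.toDir, GD, dualGD]
  rcases x with v | (⟨F, hF⟩ | c) | (e | c)
  · simp only [reduceCtorEq, if_false, zero_add, DVertex.primal.injEq, add_zero, zero_mul,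
      Finset.sum_const_zero]
    have h1 : ∑ d : G.Dart, (if d.fst = v then 1 else 0) * (φ (ε.whiteVertex d) + φ (.corner d)) =
        ∑ d : G.Dart, (if d.fst = v then 1 else 0) *
          (φ (ε.whiteVertex (ε.rot d)) + φ (.corner d)) := by
      simp only [mul_add, Finset.sum_add_distrib]
      congr 1
      rw [← Equiv.sum_comp ε.rot]
      simp only [fst_rot]
    rw [h1]
    -- Around a primal vertex an inner corner is one merged face and contributes nothing; an outer
    -- corner is cut in two by its spoke.
    have h2 : ∀ d : G.Dart, φ (ε.whiteVertex (ε.rot d)) + φ (.corner d) =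
        if h : ε.leftFace d = ε.outer then φ (.corner d) + φ (.bdWhite ⟨d, h⟩) else 0 := by
      intro d
      split
      · next h =>
        rw [whiteVertex_of_outer _ (by simpa using h), add_comm]
        simp
      · next h =>
        rw [whiteVertex_of_inner _ (by simpa using h)]
        simp [CharTwo.add_self_eq_zero]
    have h3 : ∑ c : ε.BdDart, (if c.1.fst = v then 1 else 0) *
        (φ (.corner c.1) + φ (.bdWhite c)) = ∑ d : G.Dart, (if d.fst = v then 1 else 0) *
          (φ (ε.whiteVertex (ε.rot d)) + φ (.corner d)) := by
      simp only [h2]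
      rw [← Finset.sum_subset (Finset.subset_univ
        (Finset.univ.filter fun d : G.Dart => ε.leftFace d = ε.outer)) (by
          intro d _ hd
          rw [dif_neg (by simpa using hd), mul_zero]),
        Finset.sum_subtype (p := fun d => ε.leftFace d = ε.outer) _ (by simp)]
      exact Finset.sum_congr rfl fun c _ => by rw [dif_pos c.2]
    rw [h3, CharTwo.add_self_eq_zero]
  · simp only [reduceCtorEq, if_false, zero_add, DVertex.dual.injEq, add_zero, zero_mul,
      Finset.sum_const_zero, extLeft_old_eq_inner_iff]
    simp only [extLeft, reduceCtorEq, if_false, zero_mul, Finset.sum_const_zero, add_zero]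
    -- In an inner face the white vertex is merged with the next corner along the boundary, so
    -- `facePerm` shifts one sum onto the other.
    have h1 : ∀ d : G.Dart, (if ε.leftFace d = F then 1 else 0) *
        (φ (ε.whiteVertex d.symm) + φ (.corner d)) = (if ε.leftFace d = F then 1 else 0) *
        (φ (.corner (facePerm ε.rot d)) + φ (.corner d)) := by
      intro d
      by_cases h : ε.leftFace d = F
      · rw [whiteVertex_of_inner, facePerm_apply]
        rw [← facePerm_apply, leftFace_facePerm, h]
        exact hF
      · simp [h]
    simp only [h1, mul_add, Finset.sum_add_distrib]
    rw [← Equiv.sum_comp (facePerm ε.rot)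
      (fun d => (if ε.leftFace d = F then 1 else 0) * φ (.corner d))]
    simp only [leftFace_facePerm, CharTwo.add_self_eq_zero]
  · simp only [reduceCtorEq, if_false, zero_add, DVertex.dual.injEq, add_zero, zero_mul,
      Finset.sum_const_zero, extLeft_old_eq_split_iff]
    simp only [extLeft, DualVertex.split.injEq, prevBd_eq_iff]
    simp only [ite_mul, one_mul, zero_mul, Finset.sum_ite_eq', Finset.mem_univ, if_true]
    -- Three half-edges meet at a split vertex, separating the corner of `c`, the white side of the
    -- next outer corner, and the root.
    have h : ε.whiteVertex c.1.symm = .bdWhite (ε.nextBd c) := ε.whiteVertex_of_outer _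
    rw [h]
    grind
  · simp only [reduceCtorEq, if_false, DVertex.white.injEq, ExtEdge.old.injEq, extEdge, add_zero,
      zero_mul, Finset.sum_const_zero, mul_add, Finset.sum_add_distrib]
    rw [← Equiv.sum_comp SimpleGraph.Dart.symm_involutive.toPerm
      (fun d => (if edgeOf d = e then 1 else 0) * φ (ε.whiteVertex d))]
    simp only [Function.Involutive.coe_toPerm, edgeOf_symm, CharTwo.add_self_eq_zero]
  · simp only [reduceCtorEq, if_false, DVertex.white.injEq, ExtEdge.bd.injEq, extEdge, zero_add,
      add_zero, zero_mul, Finset.sum_const_zero, ite_mul, one_mul, Finset.sum_ite_eq',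
      Finset.mem_univ, if_true]
    grind

/-- The dual of the extended double graph is connected. -/
theorem dualGD_const {X : Type*} (hG : G.Connected) (g : ε.OVertex → X)
    (hg : ∀ e, g (ε.dualGD.src e) = g (ε.dualGD.tgt e)) (x y : ε.OVertex) : g x = g y := by
  have hprimal : ∀ d, g (ε.whiteVertex d) = g (.corner d) := fun d => hg (.primal d)
  have hdual : ∀ d : G.Dart, g (ε.whiteVertex d.symm) = g (.corner d) :=
    fun d => hg (.dual (.old d))
  -- Turning around a vertex and, in `hsymm`, passing to its neighbour reduces the claim to the
  -- connectedness of `G`.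
  have hrot : ∀ d, g (.corner (ε.rot d)) = g (.corner d) := by
    intro d
    rw [← hprimal]
    by_cases h : ε.leftFace d = ε.outer
    · rw [whiteVertex_of_outer _ (by simpa using h)]
      have hb : g (.bdWhite ⟨d, h⟩) = g (.corner d) := (hg (.spoke ⟨d, h⟩)).symm
      simpa using hb
    · rw [whiteVertex_of_inner _ (by simpa using h)]
      simp
  have hsymm : ∀ d : G.Dart, g (.corner d.symm) = g (.corner d) := fun d => by
    rw [← hprimal, hdual]
  have hzpow : ∀ (n : ℕ) d, g (.corner ((ε.rot ^ n) d)) = g (.corner d) := by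
    intro n
    induction n with
    | zero => simp
    | succ n ih => intro d; rw [pow_succ', Perm.mul_apply, hrot, ih]
  have hfst : ∀ d d' : G.Dart, d.fst = d'.fst → g (.corner d) = g (.corner d') := by
    intro d d' h
    obtain ⟨n, rfl⟩ := ((ε.rot_sameCycle d d').2 h).exists_nat_pow_eq
    exact (hzpow n d).symm
  have hdart : ∀ (u v : V) (p : G.Walk u v) (d d' : G.Dart), d.fst = u → d'.fst = v →
      g (.corner d) = g (.corner d') := by
    intro u v p
    induction p with
    | nil => rintro d d' rfl h; exact hfst d d' h.symm
    | cons h p ih =>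
      intro d d' hd hd'
      rw [hfst d ⟨(_, _), h⟩ hd, ← hsymm]
      exact ih _ d' rfl hd'
  obtain ⟨c₀, hc₀⟩ := Quotient.exists_rep ε.outer
  have hall : ∀ x, g x = g (.corner c₀) := by
    have hcorner : ∀ d, g (.corner d) = g (.corner c₀) := fun d =>
      hdart _ _ (hG.preconnected d.fst c₀.fst).some d c₀ rfl rfl
    rintro (d | c | _)
    · exact hcorner d
    · exact (hg (.spoke c)).symm.trans (hcorner _)
    · exact (hg (.dual (.fromRoot ⟨c₀, hc₀⟩))).symm
  rw [hall, hall y]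

end Finiteness

/-- The extended double graph is connected. -/
theorem GD_const {X : Type*} (hG : G.Connected) (g : ε.DVertex → X)
    (hg : ∀ e, g (ε.GD.toDir.src e) = g (ε.GD.toDir.tgt e)) (x y : ε.DVertex) : g x = g y := by
  have hprimal : ∀ d : G.Dart, g (.white (.old (edgeOf d))) = g (.primal d.fst) :=
    fun d => hg (.primal d)
  have hdual : ∀ d : G.Dart, g (.white (.old (edgeOf d))) = g (.dual (ε.extLeft (.old d))) :=
    fun d => hg (.dual (.old d))
  have hV : ∀ (u v : V) (p : G.Walk u v), g (.primal u) = g (.primal v) := by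
    intro u v p
    induction p with
    | nil => rfl
    | @cons u v w h p ih =>
      have h1 := hprimal ⟨(u, v), h⟩
      have h2 := hprimal (SimpleGraph.Dart.symm ⟨(u, v), h⟩)
      rw [edgeOf_symm] at h2
      exact (h1.symm.trans h2).trans ih
  -- The outer face is a class of darts, so its existence provides an edge of `G`.
  obtain ⟨c₀, -⟩ := Quotient.exists_rep ε.outer
  have hall : ∀ x, g x = g (.primal c₀.fst) := by
    have hp : ∀ v, g (.primal v) = g (.primal c₀.fst) := fun v =>
      hV _ _ (hG.preconnected v c₀.fst).some
    have hd : ∀ d : G.Dart, g (.dual (ε.extLeft (.old d))) = g (.primal c₀.fst) := fun d =>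
      ((hdual d).symm.trans (hprimal d)).trans (hp _)
    rintro (v | (⟨F, hF⟩ | c) | (⟨e, he⟩ | c))
    · exact hp v
    · obtain ⟨d, rfl⟩ := Quotient.exists_rep F
      rw [← hd d, (ε.extLeft_old_eq_inner_iff d _ hF).2 rfl]
    · rw [← hd c.1, (ε.extLeft_old_eq_split_iff c.1 c).2 rfl]
    · induction e with
      | h u v => exact (hprimal ⟨(u, v), he⟩).trans (hp u)
    · exact (hg (.spoke c)).trans (hp _)
  rw [hall, hall y]

/-! ### Complementary spanning trees -/

section Finiteness

variable [Fintype V]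

theorem isIndep_GD_compl [DecidableEq ε.DEdge] (hG : G.Connected) {T : Finset ε.DEdge}
    (hT : ε.dualGD.IsIndep T) (hcard : T.card + 1 = Fintype.card ε.OVertex) :
    ε.GD.toDir.IsIndep Tᶜ ∧ Tᶜ.card + 1 = Fintype.card ε.DVertex := by
  have h := ε.card_dVertex_add_card_oVertex
  have hc := T.card_add_card_compl
  have hcard' : Tᶜ.card + 1 = Fintype.card ε.DVertex := by omega
  exact ⟨hT.compl ε.sum_inc_mul_inc (fun g hg => ε.GD_const hG g hg) hcard', hcard'⟩

theorem isIndep_dualGD_compl [DecidableEq ε.DEdge] (hG : G.Connected) {S : Finset ε.DEdge}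
    (hS : ε.GD.toDir.IsIndep S) (hcard : S.card + 1 = Fintype.card ε.DVertex) :
    ε.dualGD.IsIndep Sᶜ := by
  have h := ε.card_dVertex_add_card_oVertex
  have hc := S.card_add_card_compl
  refine hS.compl (fun x y => ?_) (fun g hg => ε.dualGD_const hG g hg) (by omega)
  rw [← ε.sum_inc_mul_inc y x]
  exact Finset.sum_congr rfl fun e _ => mul_comm _ _

end Finiteness

/-! ### Local constraints and weights -/

/-- Exactly one edge leaves every vertex except the root. -/
def IsChoice (T : Finset ε.OEdge) : Prop :=
  (∀ d, Xor (OEdge.crossPrimal d ∈ T) (OEdge.crossDual d.symm ∈ T)) ∧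
    ∀ c, Xor (OEdge.bdCorner c ∈ T) (OEdge.bdRoot c ∈ T)

variable {ε}

section Finiteness

variable [Fintype V]

theorem isChoice_of_isOST {T : Finset ε.OEdge} (h : ε.GO.IsOST .root T) : ε.IsChoice T := by
  obtain ⟨-, hinj, -⟩ := h.out
  refine ⟨fun d => ?_, fun c => ?_⟩
  · have hor : OEdge.crossPrimal d ∈ T ∨ OEdge.crossDual d.symm ∈ T := by
      obtain ⟨e, he, hsrc⟩ := h.2 _ (ε.whiteVertex_ne_root d)
      rcases e with d' | d' | c | c
      · exact Or.inl (ε.whiteVertex_injective hsrc ▸ he)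
      · exact Or.inr (by rwa [← ε.whiteVertex_injective hsrc, SimpleGraph.Dart.symm_symm])
      · exact (ε.whiteVertex_ne_corner d c hsrc.symm).elim
      · exact (ε.whiteVertex_ne_corner d c hsrc.symm).elim
    have hnot : ¬ (OEdge.crossPrimal d ∈ T ∧ OEdge.crossDual d.symm ∈ T) := fun ⟨h1, h2⟩ => by
      have := hinj h1 h2 (by simp [GO])
      cases this
    unfold Xor; tauto
  · have hor : OEdge.bdCorner c ∈ T ∨ OEdge.bdRoot c ∈ T := by
      obtain ⟨e, he, hsrc⟩ := h.2 (.corner c.1) (by simp)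
      rcases e with d | d | c' | c'
      · exact (ε.whiteVertex_ne_corner _ _ hsrc).elim
      · exact (ε.whiteVertex_ne_corner _ _ hsrc).elim
      · exact Or.inl (Subtype.ext (OVertex.corner.inj hsrc) ▸ he)
      · exact Or.inr (Subtype.ext (OVertex.corner.inj hsrc) ▸ he)
    have hnot : ¬ (OEdge.bdCorner c ∈ T ∧ OEdge.bdRoot c ∈ T) := fun ⟨h1, h2⟩ => by
      have := hinj h1 h2 rfl
      cases this
    unfold Xor; tauto

end Finiteness

/-- The half of the oriented tree condition that the local constraints give back; acyclicity comes
from duality. -/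
theorem IsChoice.exists_out {T : Finset ε.OEdge} (h : ε.IsChoice T) (x : ε.OVertex)
    (hx : x ≠ .root) : ∃ e ∈ T, ε.GO.src e = x := by
  rcases OVertex.exists_eq ε x with rfl | ⟨c, rfl⟩ | ⟨d, rfl⟩
  · exact (hx rfl).elim
  · rcases (h.2 c).or with hc | hc
    exacts [⟨_, hc, rfl⟩, ⟨_, hc, rfl⟩]
  · rcases (h.1 d).or with hd | hd
    exacts [⟨_, hd, rfl⟩, ⟨_, hd, by simp [GO]⟩]

variable (ε)

/-- A weight preserving injection from the edges of the directed graph to those of the extended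
double graph. Its value is the edge allowed by the local constraints when an edge is crossed. -/
def allowed : ε.OEdge ↪ ε.DEdge where
  toFun
    | .crossPrimal d => .dual (.old d.symm)
    | .crossDual d => .primal d.symm
    | .bdCorner c => .dual (.fromRoot c)
    | .bdRoot c => .spoke c
  inj' := by
    rintro (d | d | c | c) (d' | d' | c' | c') h <;>
      simp_all [SimpleGraph.Dart.symm_involutive.injective.eq_iff]

theorem rhoStar_allowed (θ : G.edgeSet → ℝ) (θb : ε.BdDart → ℝ) (e : ε.OEdge) :
    ε.rhoStar θ θb (ε.allowed e) = ε.rho θ θb e := by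
  rcases e with d | d | c | c
  · exact congrArg (fun e => Complex.I * (Real.cos (θ e) : ℂ)) (edgeOf_symm d)
  · exact congrArg (fun e => (Real.sin (θ e) : ℂ)) (edgeOf_symm d)
  · rfl
  · rfl

theorem toRoot_notMem_map_crossed (T : Finset ε.OEdge) (c : ε.BdDart) :
    DEdge.dual (.toRoot c) ∉ T.map ε.crossed := by
  rw [Finset.mem_map]
  rintro ⟨e | e | e | e, -, h⟩ <;> cases h

theorem toRoot_notMem_map_allowed (T : Finset ε.OEdge) (c : ε.BdDart) :
    DEdge.dual (.toRoot c) ∉ T.map ε.allowed := by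
  rw [Finset.mem_map]
  rintro ⟨e | e | e | e, -, h⟩ <;> cases h

variable {ε}

theorem mem_map_crossed {T : Finset ε.OEdge} :
    (∀ d, DEdge.primal d ∈ T.map ε.crossed ↔ OEdge.crossPrimal d ∈ T) ∧
    (∀ d, DEdge.dual (.old d) ∈ T.map ε.crossed ↔ OEdge.crossDual d ∈ T) ∧
    (∀ c, DEdge.spoke c ∈ T.map ε.crossed ↔ OEdge.bdCorner c ∈ T) ∧
    (∀ c, DEdge.dual (.fromRoot c) ∈ T.map ε.crossed ↔ OEdge.bdRoot c ∈ T) :=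
  ⟨fun d => Finset.mem_map' (a := OEdge.crossPrimal d) ε.crossed,
    fun d => Finset.mem_map' (a := OEdge.crossDual d) ε.crossed,
    fun c => Finset.mem_map' (a := OEdge.bdCorner c) ε.crossed,
    fun c => Finset.mem_map' (a := OEdge.bdRoot c) ε.crossed⟩

theorem mem_map_allowed {T : Finset ε.OEdge} :
    (∀ d, DEdge.primal d ∈ T.map ε.allowed ↔ OEdge.crossDual d.symm ∈ T) ∧
    (∀ d, DEdge.dual (.old d) ∈ T.map ε.allowed ↔ OEdge.crossPrimal d.symm ∈ T) ∧
    (∀ c, DEdge.spoke c ∈ T.map ε.allowed ↔ OEdge.bdRoot c ∈ T) ∧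
    (∀ c, DEdge.dual (.fromRoot c) ∈ T.map ε.allowed ↔ OEdge.bdCorner c ∈ T) :=
  ⟨fun d => by 
      rw [← Finset.mem_map' ε.allowed]
      exact iff_of_eq (congrArg (DEdge.primal · ∈ T.map ε.allowed) d.symm_symm.symm),
    fun d => by 
      rw [← Finset.mem_map' ε.allowed]
      exact iff_of_eq
        (congrArg (fun d => DEdge.dual (.old d) ∈ T.map ε.allowed) d.symm_symm.symm),
    fun c => Finset.mem_map' (a := OEdge.bdRoot c) ε.allowed,
    fun c => Finset.mem_map' (a := OEdge.bdCorner c) ε.allowed⟩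

section Finiteness

variable [Fintype V]

/-- An exclusive alternative is unchanged when both sides are negated, so it passes to the
complement. The half-edges `toRoot` required by `PointTwo` are there because nothing crosses them.
-/
theorem isChoice_iff [DecidableEq ε.DEdge] {T : Finset ε.OEdge} :
    ε.IsChoice T ↔ ε.PointOne ((T.map ε.crossed)ᶜ : Finset ε.DEdge) ∧
      ε.PointTwo ((T.map ε.crossed)ᶜ : Finset ε.DEdge) := by
  obtain ⟨h1, h2, h3, h4⟩ := mem_map_crossed (T := T)
  simp only [IsChoice, PointOne, PointTwo, Finset.mem_coe, Finset.mem_compl, h1, h2, h3, h4,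
    toRoot_notMem_map_crossed, not_false_eq_true, true_and, xor_not_not]

/-- In each pair of competing half-edges, the uncrossed one is the `allowed` partner of the edge of
`T` crossing the other. -/
theorem IsChoice.compl_eq [DecidableEq ε.DEdge] [Fintype ε.BdDart] {T : Finset ε.OEdge}
    (h : ε.IsChoice T) : (T.map ε.crossed)ᶜ =
      T.map ε.allowed ∪ Finset.univ.image (fun c => .dual (.toRoot c)) := by
  obtain ⟨h1, h2, h3, h4⟩ := mem_map_crossed (T := T)
  obtain ⟨k1, k2, k3, k4⟩ := mem_map_allowed (T := T)
  ext e
  rcases e with d | c | (d | c | c) <;>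
    simp only [Finset.mem_compl, Finset.mem_union, Finset.mem_image, Finset.mem_univ, true_and,
      reduceCtorEq, exists_false, or_false, h1, h2, h3, h4, k1, k2, k3, k4,
      toRoot_notMem_map_crossed, toRoot_notMem_map_allowed, not_false_eq_true, false_or,
      DEdge.dual.injEq, ExtDart.toRoot.injEq, exists_eq]
  · have := h.1 d
    unfold Xor at this; tauto
  · have := h.2 c
    unfold Xor at this; tauto
  · have := h.1 d.symm
    rw [SimpleGraph.Dart.symm_symm] at this
    unfold Xor at this; tauto
  · have := h.2 c
    unfold Xor at this; tauto

theorem IsChoice.prod_rhoStar [DecidableEq ε.DEdge] {T : Finset ε.OEdge} (h : ε.IsChoice T)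
    (θ : G.edgeSet → ℝ) (θb : ε.BdDart → ℝ) :
    ∏ e ∈ (T.map ε.crossed)ᶜ, ε.rhoStar θ θb e = ∏ e ∈ T, ε.rho θ θb e := by
  have := Fintype.ofFinite ε.BdDart
  rw [h.compl_eq, Finset.prod_union, Finset.prod_map,
    Finset.prod_eq_one (s := Finset.univ.image _), mul_one]
  · simp only [rhoStar_allowed]
  · intro e he
    obtain ⟨c, -, rfl⟩ := Finset.mem_image.1 he
    rfl
  · rw [Finset.disjoint_right]
    intro e he
    obtain ⟨c, -, rfl⟩ := Finset.mem_image.1 he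
    exact ε.toRoot_notMem_map_allowed T c

end Finiteness

end PlaneEmbedding

end TreesDouble

/-! ### The weight-preserving bijection -/

open TreesDouble DirMultigraph in
theorem proposition6p2 {V : Type*} [Fintype V] (G : SimpleGraph V) (hG : G.Connected)
    (ε : TreesDouble.PlaneEmbedding G) (θ : G.edgeSet → ℝ) (θb : ε.BdDart → ℝ)
    (s : ε.BdDart) :
    ε.GO.ostPartition .root (ε.rho θ θb) =
      ε.GD.ostPartitionOn (.dual (.split s)) (fun S => ε.PointOne S ∧ ε.PointTwo S)
        (ε.rhoStar θ θb) := by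
  classical
  obtain ⟨P, hPdef⟩ : ∃ P : Set ε.DEdge → Prop, P = fun S => ε.PointOne S ∧ ε.PointTwo S :=
    ⟨_, rfl⟩
  rw [← hPdef, Multigraph.ostPartitionOn_eq]
  replace hPdef : ∀ S, P S ↔ ε.PointOne S ∧ ε.PointTwo S := fun S => by rw [hPdef]
  refine Finset.sum_bij (fun T _ => (T.map ε.crossed)ᶜ) ?_ ?_ ?_ ?_
  · intro T hT
    have hT := (Finset.mem_filter.1 hT).2
    have hindep := ε.isIndep_map_crossed.2 (isIndep_of_not_hasCycle hT.1)
    exact Finset.mem_filter.2 ⟨Finset.mem_univ _,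
      ε.isIndep_GD_compl hG hindep (by rw [Finset.card_map]; exact hT.out.1),
      (hPdef _).2 <| PlaneEmbedding.isChoice_iff.1 (PlaneEmbedding.isChoice_of_isOST hT)⟩
  · intro T _ T' _ h
    exact Finset.map_injective _ (compl_injective h)
  · intro S hS
    obtain ⟨-, ⟨hS, hcard⟩, hP⟩ := Finset.mem_filter.1 hS
    rw [hPdef] at hP
    -- `PointTwo` puts every `toRoot` half-edge in `S`, so all half-edges outside `S` are crossed by
    -- edges of `GO`.
    obtain ⟨T, hT⟩ : ∃ T : Finset ε.OEdge, (T.map ε.crossed)ᶜ = S := by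
      refine ⟨Finset.univ.filter fun e => ε.crossed e ∉ S, ?_⟩
      rw [compl_eq_comm]
      ext x
      simp only [Finset.mem_compl, Finset.mem_map, Finset.mem_filter, Finset.mem_univ, true_and]
      refine ⟨fun hx => ?_, ?_⟩
      · rcases x with d | c | (d | c | c)
        · exact ⟨.crossPrimal d, hx, rfl⟩
        · exact ⟨.bdCorner c, hx, rfl⟩
        · exact ⟨.crossDual d, hx, rfl⟩
        · exact (hx (hP.2 c).1).elim
        · exact ⟨.bdRoot c, hx, rfl⟩
      · rintro ⟨e, he, rfl⟩
        exact he
    subst hT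
    have hchoice := PlaneEmbedding.isChoice_iff.2 hP
    have hindep := ε.isIndep_dualGD_compl hG hS hcard
    rw [compl_compl] at hindep
    exact ⟨T, Finset.mem_filter.2 ⟨Finset.mem_univ _,
      not_hasCycle_of_isIndep (ε.isIndep_map_crossed.1 hindep), hchoice.exists_out⟩, rfl⟩
  · intro T hT
    exact ((PlaneEmbedding.isChoice_of_isOST (Finset.mem_filter.1 hT).2).prod_rhoStar θ θb).symm
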